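/- Let $n\ge 1$, let $\beta<-n$, $r\ge 1$ and $\delta\ge 0$ be real numbers, and put $\Phi(t)=t^r(1+\log^+t)^\delta$ for $t\ge 0$, $v(x)=|x|^\beta$ and $w(x)=1/\Phi(1/v(x))$ for $x\in\mathbb R^n\setminus\{0\}$. For a measurable function $g$ on $\mathbb R^n$ and a cube $Q$ (with sides parallel to the coordinate axes) let $$\|g\|_{\Phi,Q}=\inf\Big\{\lambda>0:\ \frac1{|Q|}\int_Q\Phi\Big(\frac{|g(y)|}{\lambda}\Big)\,dy\le 1\Big\},\qquad M_\Phi g(x)=\sup_{Q\ni x}\|g\|_{\Phi,Q},$$ and let $Mg(x)=\sup_{Q\ni x}\frac1{|Q|}\int_Q|g(y)|\,dy$ be the Hardy--Littlewood maximal function. Then there is a constant $C<\infty$, depending only on $n,\beta,r,\delta$, such that for every weight $u$ (that is, every locally integrable function $u$ on $\mathbb R^n$ with $0<u(x)<\infty$ for almost every $x$), every measurable function $f:\mathbb R^n\to\mathbb R$ and every $t>0$, $$\int_{\{x\in\mathbb R^n:\ M_\Phi(fv)(x)/v(x)>t\}}u(x)\,w(x)\,dx\ \le\ C\int_{\mathbb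 R^n}\Phi\Big(\frac{|f(x)|\,v(x)}{t}\Big)\,Mu(x)\,dx .$$ -/

import Mathlib

open MeasureTheory
open scoped ENNReal NNReal

noncomputable section

namespace MixedIneq

/-- A weight on `ℝⁿ`: a locally integrable function that is positive (and finite) almost
everywhere. -/
def IsWeight {n : ℕ} (u : EuclideanSpace ℝ (Fin n) → ℝ) : Prop :=
  LocallyIntegrable u volume ∧ ∀ᵐ x ∂volume, 0 < u x

/-- The closed cube with sides parallel to the coordinate axes, lower corner `a` and side
length `l`. -/
def cube {n : ℕ} (a : EuclideanSpace ℝ (Fin n)) (l : ℝ) : Set (EuclideanSpace ℝ (Fin n)) :=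
  {y | ∀ i, a i ≤ y i ∧ y i ≤ a i + l}

/-- The Luxemburg average `‖f‖_{Φ,Q}`: the infimum of all `s > 0` for which
`(1/|Q|) ∫_Q Φ(|f|/s) ≤ 1` (it is `∞` if there is no such `s`). -/
def luxemburgAvg {n : ℕ} (Φ : ℝ → ℝ) (f : EuclideanSpace ℝ (Fin n) → ℝ)
    (Q : Set (EuclideanSpace ℝ (Fin n))) : ℝ≥0∞ :=
  ⨅ (s : ℝ) (_ : 0 < s)
    (_ : (volume Q)⁻¹ * ∫⁻ y in Q, ENNReal.ofReal (Φ (|f y| / s)) ≤ 1), ENNReal.ofReal s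

/-- The generalized maximal operator `M_Φ f (x) = sup_{Q ∋ x} ‖f‖_{Φ,Q}`, the supremum being
over all nondegenerate cubes containing `x`. -/
def orliczMaximal {n : ℕ} (Φ : ℝ → ℝ) (f : EuclideanSpace ℝ (Fin n) → ℝ)
    (x : EuclideanSpace ℝ (Fin n)) : ℝ≥0∞ :=
  ⨆ (a : EuclideanSpace ℝ (Fin n)) (l : ℝ) (_ : 0 < l) (_ : x ∈ cube a l),
    luxemburgAvg Φ f (cube a l)

/-- The (uncentered) Hardy-Littlewood maximal operator
`M f (x) = sup_{Q ∋ x} (1/|Q|) ∫_Q |f|`. -/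
def hlMaximal {n : ℕ} (f : EuclideanSpace ℝ (Fin n) → ℝ)
    (x : EuclideanSpace ℝ (Fin n)) : ℝ≥0∞ :=
  ⨆ (a : EuclideanSpace ℝ (Fin n)) (l : ℝ) (_ : 0 < l) (_ : x ∈ cube a l),
    (volume (cube a l))⁻¹ * ∫⁻ y in cube a l, ENNReal.ofReal |f y|

/-- `Φ(t) = t^r (1 + log⁺ t)^δ`, used for `t ≥ 0`. -/
def phi (r δ t : ℝ) : ℝ := t ^ r * (1 + Real.posLog t) ^ δ

/-- The power `v(x) = |x|^β`. -/
def powerWeight {n : ℕ} (β : ℝ) (x : EuclideanSpace ℝ (Fin n)) : ℝ := ‖x‖ ^ β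

/-- `w(x) = 1 / Φ(1 / v(x))` with `v(x) = |x|^β` and `Φ(t) = t^r (1 + log⁺ t)^δ`. -/
def dualWeight {n : ℕ} (r δ β : ℝ) (x : EuclideanSpace ℝ (Fin n)) : ℝ :=
  1 / phi r δ (powerWeight β x)⁻¹

end MixedIneq

end

/-! Put `G = Φ(|f| v / t)`. If `M_Φ(fv)(x) > t v(x)`, some cube `Q ∋ x` has `|Q| < ∫_Q Φ(|f| v / (t
v(x)))`; as `Φ` is submultiplicative, the right side is at most `Φ(1/v(x)) ∫_Q G`, so `w(x)|Q| ≤ ∫_Q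
G`. After enlarging `Q` to a ball `B(x, ρ)`, only three properties of the radial weight `w` matter:
it decreases, it is doubling, and `w(2^k a) 2^{kn} ≤ q^k w(a)` with `q = 2^{β+n} < 1`.

If `10ρ ≤ |x|`, then `w` on `B(x, 5ρ)` is at most a constant times `w(x)`, and a Vitali covering
suffices. Otherwise `B(x, ρ)` lies in `B(0, 11ρ)`, and half the mass of `G` on it comes from `|y| ≤
|x|` or from `|y| > |x|`. In the inner case, one bound at a point of nearly minimal norm controls
all larger dyadic annuli through a geometric series. In the outer case, `w(x)` is bounded by a tail
integral of `G(y)|y|⁻ⁿ`, and Tonelli finishes. Each time `Mu` enters as a pointwise bound for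
averages of `u`. `lintegral_radial_superlevel_le` assembles the cases. -/

section RadialWeights

open Metric Set

variable {E : Type*} [NormedAddCommGroup E] [MeasurableSpace E] {μ : Measure E}
  {U G m : E → ℝ≥0∞} {n : ℕ}

/-! ### Weighted estimates for abstract radial profiles -/

/-- The function `m` dominates `R⁻ⁿ ∫_B U` on every closed ball `B` of radius `R`. -/
def DominatesAverages (μ : Measure E) (n : ℕ) (U m : E → ℝ≥0∞) : Prop :=
  ∀ (c : E) (R : ℝ), 0 < R → ∀ z ∈ closedBall c R,
    ∫⁻ y in closedBall c R, U y ∂μ ≤ ENNReal.ofReal R ^ n * m z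

/-- A positive radial profile which is decreasing, doubling, and decays faster than `ρ⁻ⁿ` along
dyadic radii. -/
structure IsRadialProfile (n : ℕ) (ω : ℝ → ℝ≥0∞) (D q : ℝ≥0∞) : Prop where
  measurable : Measurable ω
  anti : ∀ a b : ℝ, 0 < a → a ≤ b → ω b ≤ ω a
  doubling : ∀ a : ℝ, 0 < a → ω a ≤ D * ω (2 * a)
  decay : ∀ a : ℝ, 0 < a → ∀ k : ℕ, ω (2 ^ k * a) * (2 ^ k) ^ n ≤ q ^ k * ω a

/-- The average bound holds at every point of the ball, so it can be multiplied by `G` and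
integrated over any part of the ball. -/
theorem DominatesAverages.mul_lintegral_le (hm : DominatesAverages μ n U m) {c : E} {R : ℝ}
    (hR : 0 < R) {S : Set E} (hS : MeasurableSet S) (hSR : S ⊆ closedBall c R) :
    (∫⁻ y in closedBall c R, U y ∂μ) * ∫⁻ y in S, G y ∂μ
      ≤ ENNReal.ofReal R ^ n * ∫⁻ y in S, G y * m y ∂μ := by
  refine (lintegral_const_mul_le _ _).trans ?_
  rw [← lintegral_const_mul' _ _ (ENNReal.pow_ne_top ENNReal.ofReal_ne_top)]
  refine setLIntegral_mono' hS fun z hz => ?_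
  calc (∫⁻ y in closedBall c R, U y ∂μ) * G z
      ≤ (ENNReal.ofReal R ^ n * m z) * G z := by gcongr; exact hm c R hR z (hSR hz)
    _ = _ := by ring

theorem ENNReal.le_of_mul_ofReal_pow_le {a b : ℝ≥0∞} {R : ℝ} (hR : 0 < R) (n : ℕ)
    (h : a * ENNReal.ofReal R ^ n ≤ b * ENNReal.ofReal R ^ n) : a ≤ b :=
  (ENNReal.mul_le_mul_iff_left (pow_ne_zero _ (by simpa using hR))
    (ENNReal.pow_ne_top ENNReal.ofReal_ne_top)).1 h

variable [BorelSpace E] {ω : ℝ → ℝ≥0∞} {D q : ℝ≥0∞}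

/-- Covering argument for points whose ball stays away from the origin. -/
theorem lintegral_le_of_small_balls [TopologicalSpace.SeparableSpace E] [NormedSpace ℝ E]
    (hU : AEMeasurable U μ) (hm : DominatesAverages μ n U m) (hω : IsRadialProfile n ω D q)
    (K : ℝ≥0∞) (S : Set E) (r : E → ℝ) (R : ℝ)
    (hr0 : ∀ x ∈ S, 0 < r x) (hrR : ∀ x ∈ S, r x ≤ R) (hrx : ∀ x ∈ S, 10 * r x ≤ ‖x‖)
    (hS : ∀ x ∈ S, ω ‖x‖ * ENNReal.ofReal (r x) ^ n ≤ K * ∫⁻ y in closedBall x (r x), G y ∂μ) :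
    ∫⁻ x in S, U x * ω ‖x‖ ∂μ ≤ D * K * 5 ^ n * ∫⁻ y, G y * m y ∂μ := by
  obtain ⟨T, hTS, hdis, hcov⟩ :=
    Vitali.exists_disjoint_subfamily_covering_enlargement_closedBall S id r R hrR 5 (by norm_num)
  have hTc : T.Countable := hdis.countable_of_nonempty_interior fun x hx =>
    ⟨x, ball_subset_interior_closedBall (mem_ball_self (hr0 x (hTS hx)))⟩
  have hone : ∀ x ∈ T, ∫⁻ y in closedBall x (5 * r x), U y * ω ‖y‖ ∂μ
      ≤ D * K * 5 ^ n * ∫⁻ y in closedBall x (r x), G y * m y ∂μ := by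
    intro x hx
    have h0 := hr0 x (hTS hx)
    have h1 := hrx x (hTS hx)
    have hW : ∀ y ∈ closedBall x (5 * r x), U y * ω ‖y‖ ≤ U y * (D * ω ‖x‖) := by
      intro y hy
      -- With `10 r ≤ ‖x‖` this gives `‖y‖ ≥ ‖x‖ / 2`, so one doubling suffices.
      have h2 : ‖x‖ - ‖y‖ ≤ 5 * r x := by
        rw [mem_closedBall, dist_comm, dist_eq_norm] at hy
        exact (norm_sub_norm_le _ _).trans hy
      gcongr
      calc ω ‖y‖ ≤ ω (‖x‖ / 2) := hω.anti _ _ (by linarith) (by linarith)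
        _ ≤ D * ω (2 * (‖x‖ / 2)) := hω.doubling _ (by linarith)
        _ = D * ω ‖x‖ := by congr 2; ring
    refine (setLIntegral_mono' isClosed_closedBall.measurableSet hW).trans ?_
    rw [lintegral_mul_const'' _ hU.restrict]
    apply ENNReal.le_of_mul_ofReal_pow_le h0 n
    calc (∫⁻ y in closedBall x (5 * r x), U y ∂μ) * (D * ω ‖x‖) * ENNReal.ofReal (r x) ^ n
        = D * (∫⁻ y in closedBall x (5 * r x), U y ∂μ)
          * (ω ‖x‖ * ENNReal.ofReal (r x) ^ n) := by ring
      _ ≤ D * (∫⁻ y in closedBall x (5 * r x), U y ∂μ)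
          * (K * ∫⁻ y in closedBall x (r x), G y ∂μ) := by
          gcongr _ * ?_; exact hS x (hTS hx)
      _ = D * K * ((∫⁻ y in closedBall x (5 * r x), U y ∂μ)
          * ∫⁻ y in closedBall x (r x), G y ∂μ) := by ring
      _ ≤ D * K * (ENNReal.ofReal (5 * r x) ^ n
          * ∫⁻ y in closedBall x (r x), G y * m y ∂μ) := by
          gcongr _ * ?_
          exact hm.mul_lintegral_le (by linarith) isClosed_closedBall.measurableSet
            (closedBall_subset_closedBall (by linarith))
      _ = _ := by
          rw [ENNReal.ofReal_mul (by norm_num), ENNReal.ofReal_ofNat]; ring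
  have hsub : S ⊆ ⋃ x : T, closedBall (x : E) (5 * r x) := by
    intro x hx
    obtain ⟨b, hb, hb'⟩ := hcov x hx
    exact mem_iUnion.2 ⟨⟨b, hb⟩, hb' (mem_closedBall_self (hr0 x hx).le)⟩
  have := hTc.to_subtype
  calc ∫⁻ x in S, U x * ω ‖x‖ ∂μ
      ≤ ∫⁻ x in ⋃ x : T, closedBall (x : E) (5 * r x), U x * ω ‖x‖ ∂μ := lintegral_mono_set hsub
    _ ≤ ∑' x : T, ∫⁻ y in closedBall (x : E) (5 * r x), U y * ω ‖y‖ ∂μ := lintegral_iUnion_le _ _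
    _ ≤ ∑' x : T, D * K * 5 ^ n * ∫⁻ y in closedBall (x : E) (r x), G y * m y ∂μ :=
        ENNReal.tsum_le_tsum fun x => hone x x.2
    _ = D * K * 5 ^ n * ∫⁻ y in ⋃ x ∈ T, closedBall x (r x), G y * m y ∂μ := by
        rw [ENNReal.tsum_mul_left, lintegral_biUnion hTc
          (fun _ _ => isClosed_closedBall.measurableSet) (by simpa using hdis)]
    _ ≤ _ := by gcongr; exact Measure.restrict_le_self

/-- Dyadic summation outside a ball centred at the origin. -/
theorem lintegral_compl_ball_le (hU : AEMeasurable U μ) (hm : DominatesAverages μ n U m)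
    (hω : IsRadialProfile n ω D q) (K : ℝ≥0∞) {ρ : ℝ} (hρ : 0 < ρ)
    (h : ω (2 * ρ) * ENNReal.ofReal (2 * ρ) ^ n ≤ K * ∫⁻ y in closedBall 0 (2 * ρ), G y ∂μ) :
    ∫⁻ x in {x | ρ ≤ ‖x‖}, U x * ω ‖x‖ ∂μ ≤ D * K * (1 - q)⁻¹ * ∫⁻ y, G y * m y ∂μ := by
  have hsub : {x : E | ρ ≤ ‖x‖} ⊆
      ⋃ k : ℕ, (closedBall 0 (2 ^ k * (2 * ρ)) ∩ {x | 2 ^ k * ρ ≤ ‖x‖}) := by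
    intro x hx
    obtain ⟨k, hk1, hk2⟩ := exists_nat_pow_near (x := ‖x‖ / ρ) (y := 2)
      ((one_le_div hρ).2 hx) (by norm_num)
    rw [le_div_iff₀ hρ] at hk1
    rw [div_lt_iff₀ hρ, pow_succ] at hk2
    exact mem_iUnion.2 ⟨k, by simpa using (by linarith : ‖x‖ ≤ 2 ^ k * (2 * ρ)), hk1⟩
  have hone : ∀ k : ℕ,
      ∫⁻ x in closedBall 0 (2 ^ k * (2 * ρ)) ∩ {x | 2 ^ k * ρ ≤ ‖x‖}, U x * ω ‖x‖ ∂μ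
      ≤ D * K * q ^ k * ∫⁻ y, G y * m y ∂μ := by
    intro k
    have hk : (1 : ℝ) ≤ 2 ^ k := one_le_pow₀ (by norm_num)
    have hmeas : MeasurableSet
        (closedBall (0 : E) (2 ^ k * (2 * ρ)) ∩ {x | 2 ^ k * ρ ≤ ‖x‖}) :=
      isClosed_closedBall.measurableSet.inter (measurableSet_le measurable_const measurable_norm)
    have hW : ∀ y ∈ closedBall (0 : E) (2 ^ k * (2 * ρ)) ∩ {x | 2 ^ k * ρ ≤ ‖x‖},
        U y * ω ‖y‖ ≤ U y * ω (2 ^ k * ρ) := by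
      intro y hy
      gcongr
      exact hω.anti _ _ (by positivity) hy.2
    refine (setLIntegral_mono' hmeas hW).trans ?_
    rw [lintegral_mul_const'' _ hU.restrict]
    have h2k : ENNReal.ofReal (2 ^ k * (2 * ρ)) ^ n
        = (2 ^ k) ^ n * ENNReal.ofReal (2 * ρ) ^ n := by
      rw [ENNReal.ofReal_mul (by positivity), mul_pow, ENNReal.ofReal_pow (by norm_num),
        ENNReal.ofReal_ofNat]
    apply ENNReal.le_of_mul_ofReal_pow_le (R := 2 ^ k * (2 * ρ)) (by positivity) n
    calc (∫⁻ y in closedBall 0 (2 ^ k * (2 * ρ)) ∩ {x | 2 ^ k * ρ ≤ ‖x‖}, U y ∂μ)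
          * ω (2 ^ k * ρ) * ENNReal.ofReal (2 ^ k * (2 * ρ)) ^ n
        ≤ (∫⁻ y in closedBall 0 (2 ^ k * (2 * ρ)), U y ∂μ)
          * ω (2 ^ k * ρ) * ENNReal.ofReal (2 ^ k * (2 * ρ)) ^ n := by
          gcongr; exact inter_subset_left
      _ = (∫⁻ y in closedBall 0 (2 ^ k * (2 * ρ)), U y ∂μ)
          * (ω (2 ^ k * ρ) * (2 ^ k) ^ n) * ENNReal.ofReal (2 * ρ) ^ n := by rw [h2k]; ring
      _ ≤ (∫⁻ y in closedBall 0 (2 ^ k * (2 * ρ)), U y ∂μ)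
          * (q ^ k * (D * ω (2 * ρ))) * ENNReal.ofReal (2 * ρ) ^ n := by
          gcongr _ * ?_ * _
          exact (hω.decay ρ hρ k).trans (mul_le_mul_right (hω.doubling ρ hρ) _)
      _ = D * q ^ k * ((∫⁻ y in closedBall 0 (2 ^ k * (2 * ρ)), U y ∂μ)
          * (ω (2 * ρ) * ENNReal.ofReal (2 * ρ) ^ n)) := by ring
      _ ≤ D * q ^ k * ((∫⁻ y in closedBall 0 (2 ^ k * (2 * ρ)), U y ∂μ)
          * (K * ∫⁻ y in closedBall 0 (2 * ρ), G y ∂μ)) := by gcongr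
      _ = D * K * q ^ k * ((∫⁻ y in closedBall 0 (2 ^ k * (2 * ρ)), U y ∂μ)
          * ∫⁻ y in closedBall 0 (2 * ρ), G y ∂μ) := by ring
      _ ≤ D * K * q ^ k * (ENNReal.ofReal (2 ^ k * (2 * ρ)) ^ n
          * ∫⁻ y in closedBall 0 (2 * ρ), G y * m y ∂μ) := by
          gcongr _ * ?_
          exact hm.mul_lintegral_le (by positivity) isClosed_closedBall.measurableSet
            (closedBall_subset_closedBall (le_mul_of_one_le_left (by positivity) hk))
      _ ≤ D * K * q ^ k * (ENNReal.ofReal (2 ^ k * (2 * ρ)) ^ n * ∫⁻ y, G y * m y ∂μ) := by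
          gcongr; exact Measure.restrict_le_self
      _ = _ := by ring
  calc ∫⁻ x in {x | ρ ≤ ‖x‖}, U x * ω ‖x‖ ∂μ
      ≤ _ := lintegral_mono_set hsub
    _ ≤ _ := lintegral_iUnion_le _ _
    _ ≤ ∑' k : ℕ, D * K * q ^ k * ∫⁻ y, G y * m y ∂μ := ENNReal.tsum_le_tsum hone
    _ = _ := by rw [ENNReal.tsum_mul_right, ENNReal.tsum_mul_left, ENNReal.tsum_geometric]

/-- Points where the profile is dominated by the mass of `G` in the ball through the point. -/
theorem lintegral_le_of_inner_mass (hU : AEMeasurable U μ) (hm : DominatesAverages μ n U m)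
    (hω : IsRadialProfile n ω D q) (K : ℝ≥0∞) (S : Set E) {ε : ℝ} (hε : 0 < ε)
    (hSε : ∀ x ∈ S, ε ≤ ‖x‖)
    (hS : ∀ x ∈ S, ω ‖x‖ * ENNReal.ofReal ‖x‖ ^ n ≤ K * ∫⁻ y in closedBall 0 ‖x‖, G y ∂μ) :
    ∫⁻ x in S, U x * ω ‖x‖ ∂μ ≤ D * K * (1 - q)⁻¹ * ∫⁻ y, G y * m y ∂μ := by
  rcases S.eq_empty_or_nonempty with rfl | hne
  · simp
  have hbdd : BddBelow (norm '' S) := ⟨ε, by rintro _ ⟨x, hx, rfl⟩; exact hSε x hx⟩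
  have hinf : ε ≤ sInf (norm '' S) :=
    le_csInf (hne.image _) (by rintro _ ⟨x, hx, rfl⟩; exact hSε x hx)
  -- The infimum is positive, so `x₀` can be chosen within a factor 2 of it; all of `S` then lies
  -- outside radius `‖x₀‖ / 2`.
  obtain ⟨_, ⟨x₀, hx₀, rfl⟩, hlt⟩ :=
    exists_lt_of_csInf_lt (hne.image norm) (b := 2 * sInf (norm '' S)) (by linarith)
  have h2 : 2 * (‖x₀‖ / 2) = ‖x₀‖ := by ring
  refine (lintegral_mono_set (t := {x | ‖x₀‖ / 2 ≤ ‖x‖}) fun x hx => ?_).trans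
    (lintegral_compl_ball_le (G := G) hU hm hω K (by linarith [hSε x₀ hx₀]) ?_)
  · have := csInf_le hbdd (mem_image_of_mem _ hx)
    change ‖x₀‖ / 2 ≤ ‖x‖
    linarith
  · rw [h2]; exact hS x₀ hx₀

/-- Points where the profile is dominated by the tail of a potential of `G`. -/
theorem lintegral_le_of_outer_mass [SecondCountableTopology E] [SFinite μ]
    (hU : AEMeasurable U μ) (hG : AEMeasurable G μ) (hm : DominatesAverages μ n U m)
    (hω : IsRadialProfile n ω D q) {K : ℝ≥0∞} (hK : K ≠ ∞) :
    ∫⁻ x in {x | ω ‖x‖ ≤ K * ∫⁻ y in {y | ‖x‖ < ‖y‖}, G y * (ENNReal.ofReal ‖y‖ ^ n)⁻¹ ∂μ},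
        U x * ω ‖x‖ ∂μ ≤ K * ∫⁻ y, G y * m y ∂μ := by
  -- Monotonicity in the radius gives measurability of the tail potential.
  have hmono : Antitone fun s : ℝ =>
      ∫⁻ y in {y | s < ‖y‖}, G y * (ENNReal.ofReal ‖y‖ ^ n)⁻¹ ∂μ := fun a b hab =>
    lintegral_mono_set fun y hy => lt_of_le_of_lt hab hy
  have hmeas : MeasurableSet {x : E | ω ‖x‖ ≤
      K * ∫⁻ y in {y | ‖x‖ < ‖y‖}, G y * (ENNReal.ofReal ‖y‖ ^ n)⁻¹ ∂μ} :=
    measurableSet_le (hω.measurable.comp measurable_norm)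
      ((hmono.measurable.comp measurable_norm).const_mul K)
  have hk : Measurable fun y : E => (ENNReal.ofReal ‖y‖ ^ n)⁻¹ := by fun_prop
  have hset : MeasurableSet {p : E × E | ‖p.1‖ < ‖p.2‖} :=
    measurableSet_lt (by fun_prop) (by fun_prop)
  have hlt : ∀ x : E, MeasurableSet {y : E | ‖x‖ < ‖y‖} := fun x =>
    measurableSet_lt measurable_const measurable_norm
  have hlt' : ∀ y : E, MeasurableSet {x : E | ‖x‖ < ‖y‖} := fun x =>
    measurableSet_lt measurable_norm measurable_const
  calc _ ≤ ∫⁻ x in {x | ω ‖x‖ ≤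
          K * ∫⁻ y in {y | ‖x‖ < ‖y‖}, G y * (ENNReal.ofReal ‖y‖ ^ n)⁻¹ ∂μ},
          U x * (K * ∫⁻ y in {y | ‖x‖ < ‖y‖}, G y * (ENNReal.ofReal ‖y‖ ^ n)⁻¹ ∂μ) ∂μ :=
        setLIntegral_mono' hmeas fun x hx => by gcongr; exact hx
    _ ≤ ∫⁻ x, K * (U x * ∫⁻ y in {y | ‖x‖ < ‖y‖},
          G y * (ENNReal.ofReal ‖y‖ ^ n)⁻¹ ∂μ) ∂μ := by
        refine (lintegral_mono' Measure.restrict_le_self le_rfl).trans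
          (lintegral_mono fun x => le_of_eq (by ring))
    _ = K * ∫⁻ x, ∫⁻ y, {p : E × E | ‖p.1‖ < ‖p.2‖}.indicator
          (fun p => U p.1 * (G p.2 * (ENNReal.ofReal ‖p.2‖ ^ n)⁻¹)) (x, y) ∂μ ∂μ := by
        rw [lintegral_const_mul' _ _ hK]
        congr 1
        refine lintegral_congr fun x => ?_
        rw [← lintegral_indicator (hlt x), ← lintegral_const_mul'']
        · refine lintegral_congr fun y => ?_
          by_cases hxy : ‖x‖ < ‖y‖ <;> simp [indicator, hxy]
        · exact (hG.mul hk.aemeasurable).indicator (hlt x)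
    _ = K * ∫⁻ y, ∫⁻ x, {p : E × E | ‖p.1‖ < ‖p.2‖}.indicator
          (fun p => U p.1 * (G p.2 * (ENNReal.ofReal ‖p.2‖ ^ n)⁻¹)) (x, y) ∂μ ∂μ := by
        rw [lintegral_lintegral_swap]
        exact (hU.comp_fst.mul (hG.comp_snd.mul (hk.comp measurable_snd).aemeasurable)).indicator
          hset
    _ ≤ _ := by
        gcongr with y
        have : ∀ x, {p : E × E | ‖p.1‖ < ‖p.2‖}.indicator
            (fun p => U p.1 * (G p.2 * (ENNReal.ofReal ‖p.2‖ ^ n)⁻¹)) (x, y)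
            = {x : E | ‖x‖ < ‖y‖}.indicator U x * (G y * (ENNReal.ofReal ‖y‖ ^ n)⁻¹) := by
          intro x
          by_cases hxy : ‖x‖ < ‖y‖ <;> simp [indicator, hxy]
        simp_rw [this]
        rw [lintegral_mul_const'' _ (hU.indicator (hlt' y)), lintegral_indicator (hlt' y)]
        rcases (norm_nonneg y).eq_or_lt with h0 | h0
        · have : {x : E | ‖x‖ < ‖y‖} = ∅ := by
            ext x; simp [← h0]
          simp [this]
        · have hp0 : ENNReal.ofReal ‖y‖ ^ n ≠ 0 := pow_ne_zero _ (by simpa using h0)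
          have hpt : ENNReal.ofReal ‖y‖ ^ n ≠ ∞ := ENNReal.pow_ne_top ENNReal.ofReal_ne_top
          calc (∫⁻ x in {x | ‖x‖ < ‖y‖}, U x ∂μ) * (G y * (ENNReal.ofReal ‖y‖ ^ n)⁻¹)
              ≤ (ENNReal.ofReal ‖y‖ ^ n * m y) * (G y * (ENNReal.ofReal ‖y‖ ^ n)⁻¹) := by
                gcongr
                refine (lintegral_mono_set fun x hx => ?_).trans (hm 0 ‖y‖ h0 y (by simp))
                simpa using (le_of_lt hx : ‖x‖ ≤ ‖y‖)
            _ = (ENNReal.ofReal ‖y‖ ^ n * (ENNReal.ofReal ‖y‖ ^ n)⁻¹) * (G y * m y) := by ring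
            _ = G y * m y := by rw [ENNReal.mul_inv_cancel hp0 hpt, one_mul]

/-- Weak type estimate for a centred maximal function at a radial level which decays faster
than `ρ⁻ⁿ`. -/
theorem lintegral_radial_superlevel_le [SecondCountableTopology E] [NormedSpace ℝ E] [SFinite μ]
    (hU : AEMeasurable U μ) (hG : AEMeasurable G μ) (hm : DominatesAverages μ n U m)
    (hω : IsRadialProfile n ω D q) {K : ℝ≥0∞} (hK : K ≠ ∞) :
    ∫⁻ x in {x | 0 < ‖x‖ ∧ ∃ ρ > 0, ω ‖x‖ * ENNReal.ofReal ρ ^ n ≤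
        K * ∫⁻ y in closedBall x ρ, G y ∂μ}, U x * ω ‖x‖ ∂μ
      ≤ (D * K * 5 ^ n + (D * (2 * 10 ^ n * K) * (1 - q)⁻¹ + 2 * 11 ^ n * K))
        * ∫⁻ y, G y * m y ∂μ := by
  set S : Set E := {x | 0 < ‖x‖ ∧ ∃ ρ > 0, ω ‖x‖ * ENNReal.ofReal ρ ^ n ≤
        K * ∫⁻ y in closedBall x ρ, G y ∂μ} with hSdef
  -- The upper cutoff bounds the Vitali radii, the lower one keeps the infimum of norms positive;
  -- the bounds do not depend on `N`.
  let T : ℕ → Set E := fun N => S ∩ {x | 1 / ((N : ℝ) + 1) ≤ ‖x‖ ∧ ‖x‖ ≤ N}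
  have hT : S = ⋃ N, T N := by
    refine subset_antisymm (fun x hx => ?_) (iUnion_subset fun N => inter_subset_left)
    obtain ⟨N₁, h1⟩ := exists_nat_one_div_lt hx.1
    obtain ⟨N₂, h2⟩ := exists_nat_ge ‖x‖
    refine mem_iUnion.2 ⟨max N₁ N₂, hx, ?_, h2.trans (by exact_mod_cast le_max_right _ _)⟩
    refine le_trans (one_div_le_one_div_of_le (by positivity) ?_) h1.le
    gcongr
    exact le_max_left _ _
  have hTmono : Monotone T := by
    intro M N hMN x hx
    have hMN' : (M : ℝ) ≤ N := by exact_mod_cast hMN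
    exact ⟨hx.1, (one_div_le_one_div_of_le (by positivity) (by linarith)).trans hx.2.1,
      hx.2.2.trans hMN'⟩
  rw [hT, setLIntegral_iUnion_of_directed _ hTmono.directed_le]
  refine iSup_le fun N => ?_
  choose! r hr0 hr using fun x (hx : x ∈ S) => hx.2
  let A : Set E := {x | x ∈ T N ∧ 10 * r x ≤ ‖x‖}
  let B : Set E := {x | x ∈ T N ∧
    ω ‖x‖ * ENNReal.ofReal ‖x‖ ^ n ≤ 2 * 10 ^ n * K * ∫⁻ y in closedBall 0 ‖x‖, G y ∂μ}
  let C : Set E := {x | ω ‖x‖ ≤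
    2 * 11 ^ n * K * ∫⁻ y in {y | ‖x‖ < ‖y‖}, G y * (ENNReal.ofReal ‖y‖ ^ n)⁻¹ ∂μ}
  have hsub : T N ⊆ A ∪ (B ∪ C) := by
    intro x hx
    by_cases hA : 10 * r x ≤ ‖x‖
    · exact Or.inl ⟨hx, hA⟩
    right
    push Not at hA
    have hr0x := hr0 x hx.1
    have hrpos : ENNReal.ofReal (r x) ^ n ≠ 0 := pow_ne_zero _ (by simpa using hr0x)
    -- Here `‖x‖ < 10 r x`, hence `‖y‖ ≤ ‖x‖ + r x ≤ 11 r x`.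
    have hball : closedBall x (r x) ⊆
        closedBall 0 ‖x‖ ∪ ({y | ‖x‖ < ‖y‖} ∩ closedBall 0 (11 * r x)) := by
      intro y hy
      rcases le_or_gt ‖y‖ ‖x‖ with h | h
      · left; simpa using h
      · refine Or.inr ⟨h, ?_⟩
        rw [mem_closedBall, dist_eq_norm] at hy
        have := norm_sub_norm_le y x
        simpa using (by linarith : ‖y‖ ≤ 11 * r x)
    have hmeasO : MeasurableSet ({y : E | ‖x‖ < ‖y‖} ∩ closedBall 0 (11 * r x)) :=
      (measurableSet_lt measurable_const measurable_norm).inter isClosed_closedBall.measurableSet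
    have houter : ∫⁻ y in {y | ‖x‖ < ‖y‖} ∩ closedBall 0 (11 * r x), G y ∂μ ≤
        ENNReal.ofReal (r x) ^ n *
          (11 ^ n * ∫⁻ y in {y | ‖x‖ < ‖y‖}, G y * (ENNReal.ofReal ‖y‖ ^ n)⁻¹ ∂μ) := by
      have hc : (11 ^ n * ENNReal.ofReal (r x) ^ n : ℝ≥0∞) = ENNReal.ofReal (11 * r x) ^ n := by
        rw [ENNReal.ofReal_mul (by norm_num), mul_pow, ENNReal.ofReal_ofNat]
      rw [← mul_assoc, mul_comm (ENNReal.ofReal (r x) ^ n), hc,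
        ← lintegral_const_mul' _ _ (ENNReal.pow_ne_top ENNReal.ofReal_ne_top)]
      refine (setLIntegral_mono' hmeasO fun y hy => ?_).trans
        (lintegral_mono_set inter_subset_left)
      have hy0 : 0 < ‖y‖ := (norm_nonneg x).trans_lt hy.1
      have hp0 : ENNReal.ofReal ‖y‖ ^ n ≠ 0 := pow_ne_zero _ (by simpa using hy0)
      have hpt : ENNReal.ofReal ‖y‖ ^ n ≠ ∞ := ENNReal.pow_ne_top ENNReal.ofReal_ne_top
      calc G y = (ENNReal.ofReal ‖y‖ ^ n * (ENNReal.ofReal ‖y‖ ^ n)⁻¹) * G y := by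
            rw [ENNReal.mul_inv_cancel hp0 hpt, one_mul]
        _ ≤ (ENNReal.ofReal (11 * r x) ^ n * (ENNReal.ofReal ‖y‖ ^ n)⁻¹) * G y := by
            gcongr
            simpa using hy.2
        _ = _ := by ring
    have hmain := (hr x hx.1).trans (mul_le_mul_right
      ((lintegral_mono_set hball).trans (lintegral_union_le _ _ _)) K)
    rw [mul_add] at hmain
    rcases le_total (K * ∫⁻ y in {y | ‖x‖ < ‖y‖} ∩ closedBall 0 (11 * r x), G y ∂μ)
      (K * ∫⁻ y in closedBall 0 ‖x‖, G y ∂μ) with h | h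
    · left
      refine ⟨hx, ?_⟩
      have h10 : ENNReal.ofReal ‖x‖ ^ n ≤ 10 ^ n * ENNReal.ofReal (r x) ^ n := by
        rw [← mul_pow, ← ENNReal.ofReal_ofNat, ← ENNReal.ofReal_mul (by norm_num)]
        gcongr
      calc ω ‖x‖ * ENNReal.ofReal ‖x‖ ^ n
          ≤ ω ‖x‖ * (10 ^ n * ENNReal.ofReal (r x) ^ n) := by gcongr
        _ = 10 ^ n * (ω ‖x‖ * ENNReal.ofReal (r x) ^ n) := by ring
        _ ≤ 10 ^ n * (K * ∫⁻ y in closedBall 0 ‖x‖, G y ∂μ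
            + K * ∫⁻ y in closedBall 0 ‖x‖, G y ∂μ) := by
            gcongr 10 ^ n * ?_
            exact hmain.trans (by gcongr)
        _ = _ := by ring
    · right
      apply ENNReal.le_of_mul_ofReal_pow_le hr0x n
      calc ω ‖x‖ * ENNReal.ofReal (r x) ^ n
          ≤ K * (∫⁻ y in {y | ‖x‖ < ‖y‖} ∩ closedBall 0 (11 * r x), G y ∂μ)
            + K * ∫⁻ y in {y | ‖x‖ < ‖y‖} ∩ closedBall 0 (11 * r x), G y ∂μ :=
            hmain.trans (by gcongr)
        _ = 2 * K * ∫⁻ y in {y | ‖x‖ < ‖y‖} ∩ closedBall 0 (11 * r x), G y ∂μ := by ring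
        _ ≤ 2 * K * (ENNReal.ofReal (r x) ^ n *
          (11 ^ n * ∫⁻ y in {y | ‖x‖ < ‖y‖}, G y * (ENNReal.ofReal ‖y‖ ^ n)⁻¹ ∂μ)) := by gcongr
        _ = _ := by ring
  have hA := lintegral_le_of_small_balls (G := G) hU hm hω K A r N (fun x hx => hr0 x hx.1.1)
    (fun x hx => by
      have h1 := hr0 x hx.1.1
      have h2 := hx.2
      have h3 := hx.1.2.2
      linarith) (fun x hx => hx.2) (fun x hx => hr x hx.1.1)
  have hB := lintegral_le_of_inner_mass (G := G) hU hm hω (2 * 10 ^ n * K) B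
    (ε := 1 / ((N : ℝ) + 1)) (by positivity) (fun x hx => hx.1.2.1) (fun x hx => hx.2)
  have hC := lintegral_le_of_outer_mass (G := G) hU hG hm hω (K := 2 * 11 ^ n * K)
    (by finiteness)
  rw [add_mul, add_mul]
  exact (lintegral_mono_set hsub).trans ((lintegral_union_le _ _ _).trans
    (add_le_add hA ((lintegral_union_le _ _ _).trans (add_le_add hB hC))))

end RadialWeights

/-! ### Growth of `Φ` and the dual weight -/

namespace MixedIneq

theorem phi_pos (r δ : ℝ) {t : ℝ} (ht : 0 < t) : 0 < phi r δ t := by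
  have := Real.posLog_nonneg (x := t)
  unfold phi
  positivity

theorem phi_nonneg (r δ : ℝ) {t : ℝ} (ht : 0 ≤ t) : 0 ≤ phi r δ t := by
  have := Real.posLog_nonneg (x := t)
  unfold phi
  positivity

theorem measurable_phi (r δ : ℝ) : Measurable (phi r δ) := by
  have := Real.continuous_posLog.measurable
  unfold phi
  fun_prop

theorem phi_mono {r δ : ℝ} (hr : 0 ≤ r) (hδ : 0 ≤ δ) {s t : ℝ} (hs : 0 ≤ s) (hst : s ≤ t) :
    phi r δ s ≤ phi r δ t := by
  have h1 := Real.posLog_nonneg (x := s)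
  have h2 := Real.posLog_le_posLog hs hst
  have ht : 0 ≤ t := hs.trans hst
  unfold phi
  gcongr

/-- Rests on `1 + log⁺(st) ≤ (1 + log⁺ s)(1 + log⁺ t)`. It yields doubling of `w` and lets `1/v(x)`
be pulled out of `Φ`. -/
theorem phi_mul_le {r δ : ℝ} (hδ : 0 ≤ δ) {s t : ℝ} (hs : 0 ≤ s) (ht : 0 ≤ t) :
    phi r δ (s * t) ≤ phi r δ s * phi r δ t := by
  have h1 := Real.posLog_nonneg (x := s)
  have h2 := Real.posLog_nonneg (x := t)
  have h3 := Real.posLog_nonneg (x := s * t)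
  have h4 := Real.posLog_mul (x := s) (y := t)
  unfold phi
  calc (s * t) ^ r * (1 + Real.posLog (s * t)) ^ δ
      ≤ (s ^ r * t ^ r) * ((1 + Real.posLog s) * (1 + Real.posLog t)) ^ δ := by
        rw [Real.mul_rpow hs ht]
        gcongr
        nlinarith
    _ = _ := by rw [Real.mul_rpow (by positivity) (by positivity)]; ring

theorem mul_phi_le_phi_mul {r δ : ℝ} (hr : 1 ≤ r) (hδ : 0 ≤ δ) {c t : ℝ} (hc : 1 ≤ c)
    (ht : 0 ≤ t) : c * phi r δ t ≤ phi r δ (c * t) := by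
  have h1 := Real.posLog_nonneg (x := t)
  have h2 := Real.posLog_le_posLog ht (le_mul_of_one_le_left ht hc)
  unfold phi
  calc c * (t ^ r * (1 + Real.posLog t) ^ δ)
      ≤ c ^ r * (t ^ r * (1 + Real.posLog (c * t)) ^ δ) := by
        gcongr
        exact Real.self_le_rpow_of_one_le hc hr
    _ = _ := by rw [Real.mul_rpow (by linarith) ht]; ring

/-- The dual weight `w`, as a function of the norm. -/
noncomputable def dualProfile (r δ β s : ℝ) : ℝ≥0∞ := ENNReal.ofReal (1 / phi r δ (s ^ β)⁻¹)

theorem isRadialProfile_dualProfile {n : ℕ} {β r δ : ℝ} (hβ : β < -(n : ℝ)) (hr : 1 ≤ r)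
    (hδ : 0 ≤ δ) :
    IsRadialProfile n (dualProfile r δ β) (ENNReal.ofReal (phi r δ (2 ^ (-β))))
      (ENNReal.ofReal (2 ^ (β + n))) where
  measurable := by
    have := measurable_phi r δ
    unfold dualProfile
    fun_prop
  anti a b ha hab := by
    have hb : 0 < b := ha.trans_le hab
    have hn : (0 : ℝ) ≤ n := n.cast_nonneg
    have hab' : b ^ β ≤ a ^ β := Real.rpow_le_rpow_of_nonpos ha hab (by linarith)
    refine ENNReal.ofReal_le_ofReal (one_div_le_one_div_of_le (phi_pos _ _ (by positivity)) ?_)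
    exact phi_mono (by linarith) hδ (by positivity) (by gcongr)
  doubling a ha := by
    have h2 : (0 : ℝ) < 2 ^ (-β) := by positivity
    rw [dualProfile, dualProfile, ← ENNReal.ofReal_mul (phi_nonneg _ _ h2.le)]
    apply ENNReal.ofReal_le_ofReal
    have he : ((2 * a) ^ β)⁻¹ = 2 ^ (-β) * (a ^ β)⁻¹ := by
      rw [Real.mul_rpow (by norm_num) ha.le, mul_inv, Real.rpow_neg (by norm_num)]
    have hpos : 0 < (a ^ β)⁻¹ := by positivity
    rw [he, mul_one_div, div_le_div_iff₀ (phi_pos _ _ hpos) (phi_pos _ _ (by positivity)), one_mul]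
    exact phi_mul_le hδ h2.le hpos.le
  decay a ha k := by
    have hn : (0 : ℝ) ≤ n := n.cast_nonneg
    have hpos : 0 < (a ^ β)⁻¹ := by positivity
    have hk : (1 : ℝ) ≤ 2 ^ k := one_le_pow₀ (by norm_num)
    have hc : (1 : ℝ) ≤ (2 ^ k) ^ (-β) := Real.one_le_rpow hk (by linarith)
    have he : ((2 ^ k * a) ^ β)⁻¹ = (2 ^ k) ^ (-β) * (a ^ β)⁻¹ := by
      rw [Real.mul_rpow (by positivity) ha.le, mul_inv, Real.rpow_neg (by positivity)]
    -- This reduces decay to `c Φ(s) ≤ Φ(c s)` with `c = 2^{-kβ} ≥ 1`.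
    have hq : ((2 : ℝ) ^ (β + n)) ^ k = ((2 ^ k) ^ n) / (2 ^ k) ^ (-β) := by
      rw [Real.rpow_neg (by positivity), div_inv_eq_mul, Real.rpow_add (by norm_num), mul_pow,
        Real.rpow_natCast, ← pow_mul, ← pow_mul, mul_comm n k, ← Real.rpow_natCast (2 ^ β) k,
        ← Real.rpow_mul (by norm_num), mul_comm β, Real.rpow_mul (by norm_num), Real.rpow_natCast,
        mul_comm]
    have h2 : ((2 ^ k) ^ n : ℝ≥0∞) = ENNReal.ofReal ((2 ^ k) ^ n) := by
      rw [ENNReal.ofReal_pow (by positivity), ENNReal.ofReal_pow (by norm_num),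
        ENNReal.ofReal_ofNat]
    rw [dualProfile, dualProfile, h2, ← ENNReal.ofReal_pow (by positivity),
      ← ENNReal.ofReal_mul' (by positivity), ← ENNReal.ofReal_mul (by positivity), hq, he]
    apply ENNReal.ofReal_le_ofReal
    rw [div_mul_div_comm, one_div_mul_eq_div, mul_one]
    have := phi_pos r δ hpos
    gcongr
    exact mul_phi_le_phi_mul hr hδ hc hpos.le

/-! ### Cubes, balls and the two maximal functions -/

theorem volume_cube {n : ℕ} (a : EuclideanSpace ℝ (Fin n)) (l : ℝ) :
    volume (cube a l) = ENNReal.ofReal l ^ n := by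
  have h := (EuclideanSpace.volume_preserving_symm_measurableEquiv_toLp (Fin n)).measure_preimage
    (s := Set.Icc a.ofLp (fun i => a i + l)) measurableSet_Icc.nullMeasurableSet
  have he : (MeasurableEquiv.toLp 2 (Fin n → ℝ)).symm ⁻¹' Set.Icc a.ofLp (fun i => a i + l)
      = cube a l := by
    ext y
    simp [cube, Pi.le_def, forall_and]
  rw [← he, h, Real.volume_Icc_pi]
  simp

theorem cube_subset_closedBall {n : ℕ} {a x : EuclideanSpace ℝ (Fin n)} {l : ℝ}
    (hx : x ∈ cube a l) (hl : 0 ≤ l) : cube a l ⊆ Metric.closedBall x (n * l) := by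
  intro y hy
  rw [Metric.mem_closedBall, dist_eq_norm, EuclideanSpace.norm_eq]
  apply Real.sqrt_le_iff.2 ⟨by positivity, ?_⟩
  have hi : ∀ i, ‖(y - x) i‖ ^ 2 ≤ l ^ 2 := by
    intro i
    have h1 := hx i
    have h2 := hy i
    have : ‖(y - x) i‖ ≤ l := by
      rw [Real.norm_eq_abs, PiLp.sub_apply]
      exact abs_le.2 ⟨by linarith, by linarith⟩
    gcongr
  calc ∑ i, ‖(y - x) i‖ ^ 2 ≤ ∑ _i : Fin n, l ^ 2 := Finset.sum_le_sum fun i _ => hi i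
    _ = n * l ^ 2 := by simp
    _ ≤ (n * l) ^ 2 := by
      rw [mul_pow]
      gcongr
      exact_mod_cast Nat.le_self_pow (by norm_num) n

theorem closedBall_subset_cube {n : ℕ} (c : EuclideanSpace ℝ (Fin n)) (R : ℝ) :
    Metric.closedBall c R ⊆ cube (WithLp.toLp 2 fun i => c i - R) (2 * R) := by
  intro y hy i
  rw [Metric.mem_closedBall, dist_eq_norm] at hy
  have := abs_le.1 ((PiLp.norm_apply_le (y - c) i).trans hy)
  simp only [PiLp.sub_apply] at this ⊢
  exact ⟨by linarith, by linarith⟩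

/-- A ball of radius `R` sits in a cube of side `2R`, whence the factor `2 ^ n`. -/
theorem dominatesAverages_hlMaximal {n : ℕ} (u : EuclideanSpace ℝ (Fin n) → ℝ) :
    DominatesAverages volume n (fun x => ENNReal.ofReal |u x|) (fun x => 2 ^ n * hlMaximal u x) := by
  intro c R hR z hz
  set a : EuclideanSpace ℝ (Fin n) := WithLp.toLp 2 fun i => c i - R
  have hle : (volume (cube a (2 * R)))⁻¹ * ∫⁻ y in cube a (2 * R), ENNReal.ofReal |u y|
      ≤ hlMaximal u z :=
    le_iSup₂_of_le a (2 * R) (le_iSup₂_of_le (by positivity) (closedBall_subset_cube c R hz) le_rfl)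
  have h0 : volume (cube a (2 * R)) ≠ 0 := by
    rw [volume_cube]; exact pow_ne_zero _ (by simpa using hR)
  have ht : volume (cube a (2 * R)) ≠ ∞ := by
    rw [volume_cube]; exact ENNReal.pow_ne_top ENNReal.ofReal_ne_top
  calc ∫⁻ y in Metric.closedBall c R, ENNReal.ofReal |u y|
      ≤ ∫⁻ y in cube a (2 * R), ENNReal.ofReal |u y| :=
        lintegral_mono_set (closedBall_subset_cube c R)
    _ = volume (cube a (2 * R)) * ((volume (cube a (2 * R)))⁻¹
          * ∫⁻ y in cube a (2 * R), ENNReal.ofReal |u y|) := by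
        rw [← mul_assoc, ENNReal.mul_inv_cancel h0 ht, one_mul]
    _ ≤ volume (cube a (2 * R)) * hlMaximal u z := by gcongr
    _ = _ := by
        rw [volume_cube, ENNReal.ofReal_mul (by norm_num), mul_pow, ENNReal.ofReal_ofNat]
        ring

/-- A large Luxemburg average on a cube forces a large mass of `Φ(|f| v / t)` in a ball. -/
theorem exists_ball_of_lt_orliczMaximal {n : ℕ} (hn : 1 ≤ n) {β r δ : ℝ} (hδ : 0 ≤ δ)
    {f : EuclideanSpace ℝ (Fin n) → ℝ} {t : ℝ} (ht : 0 < t) {x : EuclideanSpace ℝ (Fin n)}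
    (hx : 0 < ‖x‖)
    (h : ENNReal.ofReal t < orliczMaximal (phi r δ) (fun y => f y * powerWeight β y) x /
      ENNReal.ofReal (powerWeight β x)) :
    ∃ ρ > 0, dualProfile r δ β ‖x‖ * ENNReal.ofReal ρ ^ n ≤
      (n : ℝ≥0∞) ^ n * ∫⁻ y in Metric.closedBall x ρ,
        ENNReal.ofReal (phi r δ (|f y| * powerWeight β y / t)) := by
  have hv : 0 < powerWeight β x := Real.rpow_pos_of_pos hx β
  have hv0 : ENNReal.ofReal (powerWeight β x) ≠ 0 := by simpa using hv
  rw [ENNReal.lt_div_iff_mul_lt (Or.inl hv0) (Or.inl ENNReal.ofReal_ne_top),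
    ← ENNReal.ofReal_mul ht.le] at h
  simp only [orliczMaximal, lt_iSup_iff] at h
  obtain ⟨a, l, hl, hxQ, h⟩ := h
  refine ⟨n * l, by positivity, ?_⟩
  set P := phi r δ (powerWeight β x)⁻¹ with hPdef
  have hP : 0 < P := phi_pos _ _ (by positivity)
  -- Otherwise `t v(x)` would be admissible in the infimum defining the Luxemburg average.
  have h1 : 1 < (volume (cube a l))⁻¹ * ∫⁻ y in cube a l,
      ENNReal.ofReal (phi r δ (|f y * powerWeight β y| / (t * powerWeight β x))) := by
    by_contra hcon
    exact absurd (iInf₂_le_of_le (t * powerWeight β x) (by positivity)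
      (iInf_le_of_le (not_lt.1 hcon) le_rfl)) (not_le.2 h)
  have h2 : ∫⁻ y in cube a l,
      ENNReal.ofReal (phi r δ (|f y * powerWeight β y| / (t * powerWeight β x)))
      ≤ ENNReal.ofReal P * ∫⁻ y in Metric.closedBall x (n * l),
        ENNReal.ofReal (phi r δ (|f y| * powerWeight β y / t)) := by
    rw [← lintegral_const_mul' _ _ ENNReal.ofReal_ne_top]
    refine (lintegral_mono fun y => ?_).trans (lintegral_mono_set (cube_subset_closedBall hxQ hl.le))
    rw [← ENNReal.ofReal_mul hP.le]
    apply ENNReal.ofReal_le_ofReal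
    have hvy : 0 ≤ powerWeight β y := Real.rpow_nonneg (norm_nonneg y) β
    have he : |f y * powerWeight β y| / (t * powerWeight β x)
        = (powerWeight β x)⁻¹ * (|f y| * powerWeight β y / t) := by
      rw [abs_mul, abs_of_nonneg hvy]
      field_simp
    rw [he]
    exact phi_mul_le hδ (by positivity) (by positivity)
  have hQ0 : volume (cube a l) ≠ 0 := by
    rw [volume_cube]; exact pow_ne_zero _ (by simpa using hl)
  have hQt : volume (cube a l) ≠ ∞ := by
    rw [volume_cube]; exact ENNReal.pow_ne_top ENNReal.ofReal_ne_top
  set I := ∫⁻ y in Metric.closedBall x (n * l),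
        ENNReal.ofReal (phi r δ (|f y| * powerWeight β y / t))
  have h3 : volume (cube a l) ≤ ENNReal.ofReal P * I := by
    calc volume (cube a l) = volume (cube a l) * 1 := (mul_one _).symm
      _ ≤ volume (cube a l) * ((volume (cube a l))⁻¹ * (ENNReal.ofReal P * I)) := by
          gcongr; exact h1.le.trans (by gcongr)
      _ = _ := by rw [← mul_assoc, ENNReal.mul_inv_cancel hQ0 hQt, one_mul]
  have h4 : dualProfile r δ β ‖x‖ * ENNReal.ofReal P = 1 := by
    change ENNReal.ofReal (1 / P) * ENNReal.ofReal P = 1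
    rw [← ENNReal.ofReal_mul (by positivity), one_div_mul_cancel hP.ne', ENNReal.ofReal_one]
  calc dualProfile r δ β ‖x‖ * ENNReal.ofReal (n * l) ^ n
      = (n : ℝ≥0∞) ^ n * (dualProfile r δ β ‖x‖ * volume (cube a l)) := by
        rw [volume_cube, ENNReal.ofReal_mul (by positivity), ENNReal.ofReal_natCast, mul_pow]
        ring
    _ ≤ (n : ℝ≥0∞) ^ n * (dualProfile r δ β ‖x‖ * (ENNReal.ofReal P * I)) := by gcongr
    _ = (n : ℝ≥0∞) ^ n * I := by rw [← mul_assoc (dualProfile r δ β ‖x‖), h4, one_mul]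

end MixedIneq
-- The mixed inequality
theorem theorem3 (n : ℕ) (hn : 1 ≤ n) (β r δ : ℝ) (hβ : β < -(n : ℝ)) (hr : 1 ≤ r)
    (hδ : 0 ≤ δ) :
    ∃ C : ℝ≥0, ∀ u : EuclideanSpace ℝ (Fin n) → ℝ, MixedIneq.IsWeight u →
      ∀ f : EuclideanSpace ℝ (Fin n) → ℝ, AEMeasurable f volume → ∀ t : ℝ, 0 < t →
        ∫⁻ x in {x | ENNReal.ofReal t <
            MixedIneq.orliczMaximal (MixedIneq.phi r δ)
              (fun y => f y * MixedIneq.powerWeight β y) x /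
              ENNReal.ofReal (MixedIneq.powerWeight β x)},
          ENNReal.ofReal (u x * MixedIneq.dualWeight r δ β x)
        ≤ (C : ℝ≥0∞) * ∫⁻ x,
          ENNReal.ofReal (MixedIneq.phi r δ (|f x| * MixedIneq.powerWeight β x / t)) *
            MixedIneq.hlMaximal u x := by
  set D := ENNReal.ofReal (MixedIneq.phi r δ (2 ^ (-β)))
  set q := ENNReal.ofReal (2 ^ (β + n))
  set K : ℝ≥0∞ := (n : ℝ≥0∞) ^ n
  have hK : K ≠ ∞ := by finiteness
  have hq : (1 - q)⁻¹ ≠ ∞ := by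
    rw [ENNReal.inv_ne_top]
    refine (tsub_pos_of_lt ?_).ne'
    rw [← ENNReal.ofReal_one]
    exact (ENNReal.ofReal_lt_ofReal_iff one_pos).2
      (Real.rpow_lt_one_of_one_lt_of_neg (by norm_num) (by linarith))
  set A : ℝ≥0∞ := D * K * 5 ^ n + (D * (2 * 10 ^ n * K) * (1 - q)⁻¹ + 2 * 11 ^ n * K)
  have hA : A * 2 ^ n ≠ ∞ := by finiteness
  refine ⟨(A * 2 ^ n).toNNReal, fun u hu f hf t ht => ?_⟩
  rw [ENNReal.coe_toNNReal hA]
  have hU : AEMeasurable (fun x => ENNReal.ofReal |u x|) volume :=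
    hu.1.aestronglyMeasurable.aemeasurable.norm.ennreal_ofReal
  have hv : Measurable (MixedIneq.powerWeight (n := n) β) := by
    unfold MixedIneq.powerWeight; fun_prop
  have hG : AEMeasurable (fun x =>
      ENNReal.ofReal (MixedIneq.phi r δ (|f x| * MixedIneq.powerWeight β x / t))) volume :=
    ((MixedIneq.measurable_phi r δ).comp_aemeasurable
      ((hf.norm.mul hv.aemeasurable).div_const t)).ennreal_ofReal
  have hmain := lintegral_radial_superlevel_le hU hG (MixedIneq.dominatesAverages_hlMaximal u)
    (MixedIneq.isRadialProfile_dualProfile hβ hr hδ) hK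
  -- Makes the space nontrivial, so that the origin, where `v` takes the default value 0, is a null
  -- set.
  have hnt : Nonempty (Fin n) := ⟨⟨0, hn⟩⟩
  set S := {x : EuclideanSpace ℝ (Fin n) | 0 < ‖x‖ ∧ ∃ ρ > 0,
    MixedIneq.dualProfile r δ β ‖x‖ * ENNReal.ofReal ρ ^ n ≤ K * ∫⁻ y in Metric.closedBall x ρ,
      ENNReal.ofReal (MixedIneq.phi r δ (|f y| * MixedIneq.powerWeight β y / t))}
  have hsub : {x | ENNReal.ofReal t <
            MixedIneq.orliczMaximal (MixedIneq.phi r δ)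
              (fun y => f y * MixedIneq.powerWeight β y) x /
              ENNReal.ofReal (MixedIneq.powerWeight β x)} ⊆ {0} ∪ S := by
    intro x hx
    rcases eq_or_ne x 0 with h0 | h0
    · exact Or.inl h0
    · exact Or.inr ⟨norm_pos_iff.2 h0,
        MixedIneq.exists_ball_of_lt_orliczMaximal hn hδ ht (norm_pos_iff.2 h0) hx⟩
  calc _ ≤ ∫⁻ x in {0} ∪ S, ENNReal.ofReal (u x * MixedIneq.dualWeight r δ β x) :=
        lintegral_mono_set hsub
    _ ≤ (∫⁻ x in {0}, ENNReal.ofReal (u x * MixedIneq.dualWeight r δ β x))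
        + ∫⁻ x in S, ENNReal.ofReal (u x * MixedIneq.dualWeight r δ β x) :=
        lintegral_union_le _ _ _
    _ = ∫⁻ x in S, ENNReal.ofReal (u x * MixedIneq.dualWeight r δ β x) := by
        rw [setLIntegral_measure_zero _ _ (measure_singleton _), zero_add]
    _ ≤ ∫⁻ x in S, ENNReal.ofReal |u x| * MixedIneq.dualProfile r δ β ‖x‖ := by
        refine lintegral_mono fun x => ?_
        have hw : 0 ≤ MixedIneq.dualWeight r δ β x :=
          one_div_nonneg.2 (MixedIneq.phi_nonneg _ _
            (inv_nonneg.2 (Real.rpow_nonneg (norm_nonneg x) β)))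
        rw [ENNReal.ofReal_mul' hw]
        exact mul_le_mul' (ENNReal.ofReal_le_ofReal (le_abs_self _)) le_rfl
    _ ≤ _ := hmain
    _ = _ := by
        rw [mul_assoc A, ← lintegral_const_mul' (2 ^ n) _ (by finiteness)]
        congr 1
        refine lintegral_congr fun x => ?_
        ring
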